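/- **Theorem 5.1** (Gauss–Kuzmin type theorem). Let $m\ge 2$ be an integer, $I=[0,1]$, and let $T_m:I\to I$ be given by $T_m(0)=0$ and $$T_m(x)=\frac{m^{\,\frac{\log x^{-1}}{\log m}-\left\lfloor \frac{\log x^{-1}}{\log m}\right\rfloor}-1}{m-1}\qquad(x\neq 0).$$ Put $c_m=\dfrac{(m-1)^2}{\log\left(m^2/(2m-1)\right)}$. Let $\mu$ be a probability measure on the Borel subsets of $I$ which is absolutely continuous with respect to Lebesgue measure, and let $F_0'$ be a density of $\mu$ (where $F_0(x)=\mu([0,x))$). (i) If $F_0'$ is Riemann integrable on $I$, then for every $x\in I$ $$\lim_{n\to\infty}\mu\left(T_m^n<x\right)=\frac{c_m}{(m-1)^2}\log\frac{m((m-1)x+1)}{(m-1)x+m}.$$ (ii) If $F_0'$ is Lipschitz on $I$, then there exist two positive constants $q<1$ and $k$ (which may depend on $m$ and $\mu$) such that for all $x\in I$ and all integers $n\ge 1$ $$\mu\left(T_m^n<x\right)=\frac{c_m}{(m-1)^2}\,(1+\theta q^n)\,\log\frac{m((m-1)x+1)}{(m-1)x+m},$$ where $\theta=\theta(\mu,n,x)$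 satisfies $|\theta|\le k$. -/

import Mathlib

open MeasureTheory Set Filter Topology
open scoped NNReal ENNReal

namespace GaussKuzmin

noncomputable section

/-- The unit interval `I = [0, 1]`. -/
abbrev I : Set ℝ := Set.Icc 0 1

/-- The first incomplete quotient `a₁(x) = ⌊log x⁻¹ / log m⌋` of a point `x ≠ 0` of `I`. -/
def firstQuotient (m : ℕ) (x : ℝ) : ℤ := ⌊Real.log x⁻¹ / Real.log m⌋

/-- The shift transformation `T_m` of the expansion
`x = m^{-a₁} / (1 + (m-1) m^{-a₂} / (1 + (m-1) m^{-a₃} / (1 + ⋯)))`: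
`T_m 0 = 0`, and `T_m x = (m ^ (log x⁻¹ / log m - ⌊log x⁻¹ / log m⌋) - 1) / (m - 1)` for `x ≠ 0`. -/
def T (m : ℕ) (x : ℝ) : ℝ :=
  if x = 0 then 0
  else ((m : ℝ) ^ (Real.log x⁻¹ / Real.log m - (firstQuotient m x : ℝ)) - 1) / ((m : ℝ) - 1)

/-- The constant `c_m = (m-1)² / log (m² / (2m-1))`. -/
def c (m : ℕ) : ℝ := ((m : ℝ) - 1) ^ 2 / Real.log ((m : ℝ) ^ 2 / (2 * (m : ℝ) - 1))

/-- `h` is a density with respect to Lebesgue measure of the measure `μ` on `I`; in particular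
`μ` is carried by `I`. Only the values of `h` on `I`, up to a null set, matter. -/
def IsDensity (μ : Measure ℝ) (h : ℝ → ℝ) : Prop :=
  (∀ᵐ x ∂(volume.restrict I), 0 ≤ h x) ∧
    μ = (volume.restrict I).withDensity (fun x => ENNReal.ofReal (h x))

/-- The unit interval as a one-dimensional box. -/
def unitBox : BoxIntegral.Box (Fin 1) where
  lower := fun _ => 0
  upper := fun _ => 1
  lower_lt_upper := fun _ => zero_lt_one

/-- `h` is Riemann integrable on `[0, 1]`: its Riemann sums over tagged partitions of `[0, 1]`
converge as the mesh tends to zero. -/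
def RiemannIntegrable (h : ℝ → ℝ) : Prop :=
  BoxIntegral.Integrable unitBox BoxIntegral.IntegrationParams.Riemann
    (fun v : Fin 1 → ℝ => h (v 0)) BoxIntegral.BoxAdditiveMap.volume

end

end GaussKuzmin

namespace GaussKuzmin

noncomputable section

/-! Write P for `transfer m` and ρ for `gaussDensity m`. Changing variables on the inverse branches
turns the mass of {T^n < x} under a density f into the integral of P^n f over [0, x), so the theorem
is about the convergence of P^n f to (∫ f) ρ. That ρ is fixed by P is a telescoping series.

The rate comes from a cone argument. In the coordinate t = log(1 + (m-1)x) every branch contracts by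
(m-1)/m, and every branch weight is a multiple of exp(-2t). Hence P maps the cone of exponent L into
that of exponent (m-1)/m * L + 2, and L = 4m leaves slack 2 (`LogLipschitz.transfer_self`). The
slack allows a fixed proportion of the mass to be split off as a multiple of ρ while the remainder
stays in the cone (`LogLipschitz.transfer_sub`). Iterating, the unmerged mass decays geometrically.
Cone functions are comparable to their integrals, so the error is bounded pointwise by a multiple of
ρ, and after integration by a multiple of `gaussCDF m x`, as a multiplicative error term requires.

A Lipschitz density is a difference of two cone functions, which gives (ii). For (i), an integrable
density is approximated in L¹ by polynomials. -/

/-- The inverse branch of `T m` with first quotient `i`. -/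
def invBranch (m i : ℕ) (y : ℝ) : ℝ := ((m : ℝ) ^ i)⁻¹ / (1 + ((m : ℝ) - 1) * y)

/-- The absolute value of the derivative of `invBranch m i`. -/
def branchWeight (m i : ℕ) (y : ℝ) : ℝ :=
  ((m : ℝ) - 1) * ((m : ℝ) ^ i)⁻¹ / (1 + ((m : ℝ) - 1) * y) ^ 2

/-- The transfer operator of `T m` with respect to Lebesgue measure on `I`. -/
def transfer (m : ℕ) (f : ℝ → ℝ) (x : ℝ) : ℝ :=
  ∑' i, branchWeight m i x * f (invBranch m i x)

/-- The density of the invariant probability measure of `T m`. -/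
def gaussDensity (m : ℕ) (x : ℝ) : ℝ :=
  c m / ((((m : ℝ) - 1) * x + 1) * (((m : ℝ) - 1) * x + m))

/-- The coordinate in which all inverse branches of `T m` are uniform contractions. -/
def logCoord (m : ℕ) (x : ℝ) : ℝ := Real.log (1 + ((m : ℝ) - 1) * x)

/-- The distance on `I` given by the coordinate `logCoord m`. -/
def logDist (m : ℕ) (x y : ℝ) : ℝ := |logCoord m x - logCoord m y|

/-- The cone of nonnegative functions on `I` whose logarithm is `L`-Lipschitz for `logDist m`. -/
structure LogLipschitz (m : ℕ) (L : ℝ) (f : ℝ → ℝ) : Prop where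
  nonneg : ∀ x ∈ I, 0 ≤ f x
  le : ∀ x ∈ I, ∀ y ∈ I, f x ≤ Real.exp (L * logDist m x y) * f y

lemma two_le_cast {m : ℕ} (hm : 2 ≤ m) : (2 : ℝ) ≤ m := by exact_mod_cast hm

/-! ### Inverse branches of T. -/

section Branches

variable {m : ℕ}

lemma one_le_affine (hm : 2 ≤ m) {x : ℝ} (hx : x ∈ I) : 1 ≤ 1 + ((m : ℝ) - 1) * x := by
  have := two_le_cast hm
  nlinarith [hx.1]

lemma affine_le (hm : 2 ≤ m) {x : ℝ} (hx : x ∈ I) : 1 + ((m : ℝ) - 1) * x ≤ m := by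
  have := two_le_cast hm
  nlinarith [hx.2]

lemma inv_pow_pos (hm : 2 ≤ m) (i : ℕ) : 0 < ((m : ℝ) ^ i)⁻¹ := by
  have := two_le_cast hm
  positivity

lemma inv_pow_le_one (hm : 2 ≤ m) (i : ℕ) : ((m : ℝ) ^ i)⁻¹ ≤ 1 :=
  inv_le_one_of_one_le₀ (one_le_pow₀ (by linarith [two_le_cast hm]))

lemma summable_inv_pow (hm : 2 ≤ m) : Summable fun i : ℕ => ((m : ℝ) ^ i)⁻¹ := by
  have := two_le_cast hm
  simp_rw [← inv_pow]
  exact summable_geometric_of_lt_one (by positivity) (inv_lt_one_of_one_lt₀ (by linarith))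

lemma invBranch_pos (hm : 2 ≤ m) (i : ℕ) {x : ℝ} (hx : x ∈ I) : 0 < invBranch m i x :=
  div_pos (inv_pow_pos hm i) (by linarith [one_le_affine hm hx])

lemma invBranch_mem (hm : 2 ≤ m) (i : ℕ) {x : ℝ} (hx : x ∈ I) : invBranch m i x ∈ I := by
  refine ⟨(invBranch_pos hm i hx).le, ?_⟩
  have h1 := one_le_affine hm hx
  rw [invBranch, div_le_one (by linarith)]
  exact (inv_pow_le_one hm i).trans h1

lemma branchWeight_nonneg (hm : 2 ≤ m) (i : ℕ) (x : ℝ) : 0 ≤ branchWeight m i x := by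
  have := two_le_cast hm
  have : 0 ≤ (m : ℝ) - 1 := by linarith
  unfold branchWeight
  positivity

lemma branchWeight_le (hm : 2 ≤ m) (i : ℕ) {x : ℝ} (hx : x ∈ I) :
    branchWeight m i x ≤ ((m : ℝ) - 1) * ((m : ℝ) ^ i)⁻¹ := by
  have := two_le_cast hm
  have h0 : 0 ≤ (m : ℝ) - 1 := by linarith
  exact div_le_self (mul_nonneg h0 (inv_pow_pos hm i).le) (one_le_pow₀ (one_le_affine hm hx))

lemma hasDerivAt_invBranch (hm : 2 ≤ m) (i : ℕ) {x : ℝ} (hx : x ∈ I) :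
    HasDerivAt (invBranch m i) (-branchWeight m i x) x := by
  have h1 := one_le_affine hm hx
  have h : HasDerivAt (fun y : ℝ => 1 + ((m : ℝ) - 1) * y) ((m : ℝ) - 1) x := by
    simpa using ((hasDerivAt_id x).const_mul ((m : ℝ) - 1)).const_add 1
  have h2 := (hasDerivAt_const x ((m : ℝ) ^ i)⁻¹).div h (by linarith)
  refine h2.congr_deriv ?_
  rw [branchWeight]
  ring

lemma continuousOn_invBranch (hm : 2 ≤ m) (i : ℕ) : ContinuousOn (invBranch m i) I :=
  fun _ hx => (hasDerivAt_invBranch hm i hx).continuousAt.continuousWithinAt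

lemma continuousOn_branchWeight (hm : 2 ≤ m) (i : ℕ) : ContinuousOn (branchWeight m i) I := by
  refine ContinuousOn.div (by fun_prop) (by fun_prop) fun x hx => ?_
  have := one_le_affine hm hx
  positivity

lemma log_inv_invBranch (hm : 2 ≤ m) (i : ℕ) {y : ℝ} (hy : y ∈ I) :
    Real.log (invBranch m i y)⁻¹ / Real.log m = i + logCoord m y / Real.log m := by
  have h2 := two_le_cast hm
  have h1 := one_le_affine hm hy
  have hl : Real.log m ≠ 0 := (Real.log_pos (by linarith)).ne'
  rw [invBranch, inv_div, div_inv_eq_mul, Real.log_mul (by positivity) (by positivity),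
    Real.log_pow, logCoord]
  field_simp
  ring

/-- The point y = 1 is excluded: its image m^(-(i+1)) is also the image of 0 under branch i + 1, and
the floor jumps there. -/
lemma firstQuotient_invBranch (hm : 2 ≤ m) (i : ℕ) {y : ℝ} (hy : y ∈ Ico (0 : ℝ) 1) :
    firstQuotient m (invBranch m i y) = i := by
  have h2 := two_le_cast hm
  have hy' := Ico_subset_Icc_self hy
  have h1 := one_le_affine hm hy'
  have hl : 0 < Real.log m := Real.log_pos (by linarith)
  rw [firstQuotient, log_inv_invBranch hm i hy', Int.floor_eq_iff]
  have h3 : 0 ≤ logCoord m y / Real.log m := div_nonneg (Real.log_nonneg h1) hl.le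
  have h4 : logCoord m y / Real.log m < 1 := by
    rw [div_lt_one hl]
    exact Real.log_lt_log (by linarith) (by nlinarith [hy.2])
  constructor <;> push_cast <;> linarith

lemma T_invBranch (hm : 2 ≤ m) (i : ℕ) {y : ℝ} (hy : y ∈ Ico (0 : ℝ) 1) :
    T m (invBranch m i y) = y := by
  have h2 := two_le_cast hm
  have hy' := Ico_subset_Icc_self hy
  have h1 := one_le_affine hm hy'
  have hl : 0 < Real.log m := Real.log_pos (by linarith)
  have hm1 : (m : ℝ) - 1 ≠ 0 := by linarith
  rw [T, if_neg (invBranch_pos hm i hy').ne', firstQuotient_invBranch hm i hy,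
    log_inv_invBranch hm i hy', Int.cast_natCast, add_sub_cancel_left, logCoord,
    Real.rpow_def_of_pos (by linarith), mul_div_cancel₀ _ hl.ne', Real.exp_log (by linarith)]
  field_simp
  ring

lemma exists_eq_invBranch (hm : 2 ≤ m) {x : ℝ} (hx : x ∈ I) (hx0 : x ≠ 0) :
    ∃ i, ∃ y ∈ Ico (0 : ℝ) 1, x = invBranch m i y := by
  have h2 := two_le_cast hm
  have hpos : 0 < x := lt_of_le_of_ne hx.1 hx0.symm
  obtain ⟨i, hi1, hi2⟩ := exists_nat_pow_near (one_le_inv_iff₀.2 ⟨hpos, hx.2⟩)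
    (show (1 : ℝ) < m by linarith)
  have hp : (0 : ℝ) < (m : ℝ) ^ i := by positivity
  have hm1 : 0 < (m : ℝ) - 1 := by linarith
  refine ⟨i, (x⁻¹ / (m : ℝ) ^ i - 1) / ((m : ℝ) - 1), ⟨?_, ?_⟩, ?_⟩
  · exact div_nonneg (sub_nonneg.2 ((one_le_div hp).2 hi1)) hm1.le
  · rw [div_lt_one hm1]
    have : x⁻¹ / (m : ℝ) ^ i < m := by
      rw [div_lt_iff₀ hp]
      rwa [pow_succ'] at hi2
    linarith
  · rw [invBranch, mul_div_cancel₀ _ hm1.ne']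
    field_simp
    ring

lemma measurable_T (m : ℕ) : Measurable (T m) := by
  unfold T firstQuotient
  refine Measurable.ite (measurableSet_singleton 0) measurable_const ?_
  have h : Measurable fun x : ℝ => Real.log x⁻¹ / Real.log m := by fun_prop
  have h' : Measurable fun x : ℝ => ((⌊Real.log x⁻¹ / Real.log m⌋ : ℤ) : ℝ) :=
    (measurable_from_top (f := fun z : ℤ => (z : ℝ))).comp (Int.measurable_floor.comp h)
  fun_prop

lemma preimage_T_eq_iUnion (hm : 2 ≤ m) (A : Set ℝ) :
    ((I ∩ T m ⁻¹' A) \ {0} : Set ℝ) = ⋃ i, invBranch m i '' (Ico 0 1 ∩ A) := by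
  ext x
  simp only [mem_inter_iff, Set.mem_sdiff, mem_preimage, mem_singleton_iff, mem_iUnion, mem_image]
  constructor
  · rintro ⟨⟨hx, hA⟩, hx0⟩
    obtain ⟨i, y, hy, rfl⟩ := exists_eq_invBranch hm hx hx0
    rw [T_invBranch hm i hy] at hA
    exact ⟨i, y, ⟨hy, hA⟩, rfl⟩
  · rintro ⟨i, y, ⟨hy, hA⟩, rfl⟩
    have hy' := Ico_subset_Icc_self hy
    exact ⟨⟨invBranch_mem hm i hy', by rwa [T_invBranch hm i hy]⟩, (invBranch_pos hm i hy').ne'⟩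

lemma injOn_invBranch (hm : 2 ≤ m) (i : ℕ) : InjOn (invBranch m i) (Ico 0 1) := by
  intro x hx y hy h
  rw [← T_invBranch hm i hx, h, T_invBranch hm i hy]

lemma disjoint_image_invBranch (hm : 2 ≤ m) (A : Set ℝ) :
    Pairwise (Function.onFun Disjoint fun i => invBranch m i '' (Ico 0 1 ∩ A)) := by
  intro i j hij
  refine Set.disjoint_left.2 ?_
  rintro _ ⟨x, hx, rfl⟩ ⟨y, hy, h⟩
  have := firstQuotient_invBranch hm i hx.1
  rw [← h, firstQuotient_invBranch hm j hy.1] at this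
  exact hij (by exact_mod_cast this.symm)

end Branches

/-! ### The transfer operator and its duality with T. -/

section Transfer

variable {m : ℕ}

lemma summable_transfer (hm : 2 ≤ m) {f : ℝ → ℝ} {B : ℝ} (hB : ∀ x ∈ I, |f x| ≤ B) {x : ℝ}
    (hx : x ∈ I) : Summable fun i => branchWeight m i x * f (invBranch m i x) := by
  have h2 := two_le_cast hm
  refine Summable.of_norm_bounded (((summable_inv_pow hm).mul_left ((m : ℝ) - 1)).mul_right B)
    fun i => ?_
  rw [norm_mul, Real.norm_eq_abs, Real.norm_eq_abs, abs_of_nonneg (branchWeight_nonneg hm i x)]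
  exact mul_le_mul (branchWeight_le hm i hx) (hB _ (invBranch_mem hm i hx)) (abs_nonneg _)
    (mul_nonneg (by linarith) (inv_pow_pos hm i).le)

/-- Change of variables on each branch, then summation over the branches. The points 0 and 1, where
the branch description fails, form a null set. -/
lemma setIntegral_preimage_T (hm : 2 ≤ m) {f : ℝ → ℝ} (hf : ContinuousOn f I) {A : Set ℝ}
    (hA : MeasurableSet A) :
    ∫ x in I ∩ T m ⁻¹' A, f x = ∫ x in I ∩ A, transfer m f x := by
  have h2 := two_le_cast hm
  have hae : ∀ B : Set ℝ, (B \ {0} : Set ℝ) =ᵐ[volume] B := fun B =>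
    sdiff_null_ae_eq_self (by simp)
  obtain ⟨B, hB⟩ := isCompact_Icc.exists_bound_of_continuousOn hf
  have hS : MeasurableSet (Ico (0 : ℝ) 1 ∩ A) := measurableSet_Ico.inter hA
  have hSI : Ico (0 : ℝ) 1 ∩ A ⊆ I := inter_subset_left.trans Ico_subset_Icc_self
  have hder : ∀ i, ∀ x ∈ Ico (0 : ℝ) 1 ∩ A,
      HasDerivWithinAt (invBranch m i) (-branchWeight m i x) (Ico (0 : ℝ) 1 ∩ A) x :=
    fun i x hx => (hasDerivAt_invBranch hm i (hSI hx)).hasDerivWithinAt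
  have hinj : ∀ i, InjOn (invBranch m i) (Ico (0 : ℝ) 1 ∩ A) := fun i =>
    (injOn_invBranch hm i).mono inter_subset_left
  have hsum1 : HasSum (fun i => ∫ x in invBranch m i '' (Ico (0 : ℝ) 1 ∩ A), f x)
      (∫ x in I ∩ T m ⁻¹' A, f x) := by
    rw [← setIntegral_congr_set (hae (I ∩ T m ⁻¹' A)), preimage_T_eq_iUnion hm]
    refine hasSum_integral_iUnion (fun i => ?_) (disjoint_image_invBranch hm A) ?_
    · exact measurable_image_of_fderivWithin hS
        (fun x hx => (hder i x hx).hasFDerivWithinAt) (hinj i)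
    · rw [← preimage_T_eq_iUnion hm]
      exact hf.integrableOn_Icc.mono_set (sdiff_subset.trans inter_subset_left)
  have hsum2 : HasSum (fun i => ∫ x in Ico (0 : ℝ) 1 ∩ A, branchWeight m i x * f (invBranch m i x))
      (∫ x in Ico (0 : ℝ) 1 ∩ A, transfer m f x) := by
    refine hasSum_integral_of_dominated_convergence
      (fun i _ => ((m : ℝ) - 1) * ((m : ℝ) ^ i)⁻¹ * B) (fun i => ?_) (fun i => ?_) ?_ ?_ ?_
    · exact (((continuousOn_branchWeight hm i).mul (hf.comp (continuousOn_invBranch hm i)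
        fun x hx => invBranch_mem hm i hx)).mono hSI).aestronglyMeasurable hS
    · refine ae_restrict_of_forall_mem hS fun x hx => ?_
      rw [norm_mul, Real.norm_eq_abs, abs_of_nonneg (branchWeight_nonneg hm i x)]
      exact mul_le_mul (branchWeight_le hm i (hSI hx)) (hB _ (invBranch_mem hm i (hSI hx)))
        (norm_nonneg _) (mul_nonneg (by linarith) (inv_pow_pos hm i).le)
    · exact ae_of_all _ fun _ => ((summable_inv_pow hm).mul_left _).mul_right B
    · refine integrableOn_const ?_
      exact ((measure_mono hSI).trans_lt (by simp)).ne
    · refine ae_restrict_of_forall_mem hS fun x hx => ?_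
      exact (summable_transfer hm hB (hSI hx)).hasSum
  have hI : (Ico (0 : ℝ) 1 ∩ A : Set ℝ) =ᵐ[volume] (I ∩ A : Set ℝ) :=
    Ico_ae_eq_Icc.inter (ae_eq_refl _)
  rw [← setIntegral_congr_set hI]
  refine hsum1.unique ?_
  convert hsum2 using 2 with i
  rw [integral_image_eq_integral_abs_deriv_smul hS (hder i) (hinj i)]
  refine setIntegral_congr_fun hS fun x _ => ?_
  simp only [abs_neg, abs_of_nonneg (branchWeight_nonneg hm i x), smul_eq_mul]

lemma transfer_congr (hm : 2 ≤ m) {f g : ℝ → ℝ} (h : EqOn f g I) :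
    EqOn (transfer m f) (transfer m g) I := fun _ hx =>
  tsum_congr fun i => by rw [h (invBranch_mem hm i hx)]

lemma transfer_add_smul (hm : 2 ≤ m) {f g : ℝ → ℝ} (hf : ContinuousOn f I) (hg : ContinuousOn g I)
    (a b : ℝ) {x : ℝ} (hx : x ∈ I) :
    transfer m (fun y => a * f y + b * g y) x = a * transfer m f x + b * transfer m g x := by
  obtain ⟨B, hB⟩ := isCompact_Icc.exists_bound_of_continuousOn hf
  obtain ⟨B', hB'⟩ := isCompact_Icc.exists_bound_of_continuousOn hg
  have h1 := (summable_transfer hm hB hx).mul_left a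
  have h2 := (summable_transfer hm hB' hx).mul_left b
  simp only [transfer]
  rw [← tsum_mul_left, ← tsum_mul_left, ← h1.tsum_add h2]
  exact tsum_congr fun i => by ring

end Transfer

/-! ### Contraction in the logarithmic coordinate. -/

section LogDist

variable {m : ℕ}

lemma logDist_nonneg (m : ℕ) (x y : ℝ) : 0 ≤ logDist m x y := abs_nonneg _

lemma logDist_comm (m : ℕ) (x y : ℝ) : logDist m x y = logDist m y x := abs_sub_comm _ _

lemma logCoord_nonneg (hm : 2 ≤ m) {x : ℝ} (hx : x ∈ I) : 0 ≤ logCoord m x :=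
  Real.log_nonneg (one_le_affine hm hx)

lemma logCoord_le (hm : 2 ≤ m) {x : ℝ} (hx : x ∈ I) : logCoord m x ≤ Real.log m :=
  Real.log_le_log (by linarith [one_le_affine hm hx]) (affine_le hm hx)

lemma logDist_le (hm : 2 ≤ m) {x y : ℝ} (hx : x ∈ I) (hy : y ∈ I) : logDist m x y ≤ Real.log m :=
  abs_sub_le_of_nonneg_of_le (logCoord_nonneg hm hx) (logCoord_le hm hx) (logCoord_nonneg hm hy)
    (logCoord_le hm hy)

lemma exp_logCoord (hm : 2 ≤ m) {x : ℝ} (hx : x ∈ I) :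
    Real.exp (logCoord m x) = 1 + ((m : ℝ) - 1) * x :=
  Real.exp_log (by linarith [one_le_affine hm hx])

lemma affine_le_exp_logDist (hm : 2 ≤ m) {x y : ℝ} (hx : x ∈ I) (hy : y ∈ I) :
    1 + ((m : ℝ) - 1) * y ≤ Real.exp (logDist m x y) * (1 + ((m : ℝ) - 1) * x) := by
  rw [← exp_logCoord hm hx, ← exp_logCoord hm hy, ← Real.exp_add]
  refine Real.exp_le_exp.2 ?_
  have := neg_abs_le (logCoord m x - logCoord m y)
  rw [logDist]
  linarith

lemma abs_sub_le_logDist (hm : 2 ≤ m) {x y : ℝ} (hx : x ∈ I) (hy : y ∈ I) :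
    |x - y| ≤ m * logDist m x y := by
  wlog h : x ≤ y generalizing x y
  · rw [abs_sub_comm, logDist_comm]
    exact this hy hx (le_of_not_ge h)
  have h2 := two_le_cast hm
  have h1 := one_le_affine hm hx
  have h1' := one_le_affine hm hy
  have h3 := affine_le hm hy
  have hlog := Real.one_sub_inv_le_log_of_pos
    (show 0 < (1 + ((m : ℝ) - 1) * y) / (1 + ((m : ℝ) - 1) * x) by positivity)
  rw [Real.log_div (by positivity) (by positivity), inv_div] at hlog
  have hd : logCoord m y - logCoord m x ≤ logDist m x y := by
    rw [logDist_comm]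
    exact le_abs_self _
  have h4 : (y - x) / m ≤ 1 - (1 + ((m : ℝ) - 1) * x) / (1 + ((m : ℝ) - 1) * y) := by
    rw [one_sub_div (by positivity)]
    refine div_le_div₀ ?_ ?_ (by positivity) h3 <;> nlinarith
  rw [abs_sub_comm, abs_of_nonneg (by linarith), ← div_le_iff₀' (by linarith)]
  exact (h4.trans hlog).trans hd

/-- In the coordinate t the branch is t ↦ log(1 + a exp(-t)) with a ≤ m - 1. Its derivative has
modulus v / (1 + v) with v = a exp(-t) ≤ m - 1. -/
lemma logDist_invBranch_le (hm : 2 ≤ m) (i : ℕ) {x y : ℝ} (hx : x ∈ I) (hy : y ∈ I) :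
    logDist m (invBranch m i x) (invBranch m i y) ≤ ((m : ℝ) - 1) / m * logDist m x y := by
  have h2 := two_le_cast hm
  set a : ℝ := ((m : ℝ) - 1) * ((m : ℝ) ^ i)⁻¹ with ha
  have ha0 : 0 ≤ a := mul_nonneg (by linarith) (inv_pow_pos hm i).le
  have ha1 : a ≤ m - 1 := mul_le_of_le_one_right (by linarith) (inv_pow_le_one hm i)
  have hψ : ∀ z ∈ I, logCoord m (invBranch m i z)
      = (fun t => Real.log (1 + a * Real.exp (-t))) (logCoord m z) := by
    intro z hz
    have h1 := one_le_affine hm hz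
    simp only [Real.exp_neg, exp_logCoord hm hz]
    rw [logCoord, invBranch, ha]
    congr 1
    ring
  have hder : ∀ t ∈ Ici (0 : ℝ), HasDerivWithinAt (fun t => Real.log (1 + a * Real.exp (-t)))
      (-(a * Real.exp (-t)) / (1 + a * Real.exp (-t))) (Ici 0) t := by
    intro t _
    have h := (((Real.hasDerivAt_exp (-t)).comp t (hasDerivAt_neg t)).const_mul a).const_add 1
    have h' := h.log (show (1 + a * Real.exp (-t)) ≠ 0 by positivity)
    refine (h'.congr_deriv ?_).hasDerivWithinAt
    simp
  have hbd : ∀ t ∈ Ici (0 : ℝ),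
      ‖-(a * Real.exp (-t)) / (1 + a * Real.exp (-t))‖ ≤ ((m : ℝ) - 1) / m := by
    intro t ht
    have hv0 : 0 ≤ a * Real.exp (-t) := by positivity
    have hv : a * Real.exp (-t) ≤ m - 1 :=
      (mul_le_of_le_one_right ha0 (Real.exp_le_one_iff.2 (by simpa using ht))).trans ha1
    rw [norm_div, norm_neg, Real.norm_eq_abs, Real.norm_eq_abs, abs_of_nonneg hv0,
      abs_of_nonneg (by linarith), div_le_div_iff₀ (by linarith) (by linarith)]
    nlinarith
  rw [logDist, logDist, hψ x hx, hψ y hy]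
  exact Convex.norm_image_sub_le_of_norm_hasDerivWithin_le hder hbd (convex_Ici 0)
    (logCoord_nonneg hm hy) (logCoord_nonneg hm hx)

lemma branchWeight_le_exp_logDist (hm : 2 ≤ m) (i : ℕ) {x y : ℝ} (hx : x ∈ I) (hy : y ∈ I) :
    branchWeight m i x ≤ Real.exp (2 * logDist m x y) * branchWeight m i y := by
  have h2 := two_le_cast hm
  have h1 := one_le_affine hm hx
  have h1' := one_le_affine hm hy
  have h := affine_le_exp_logDist hm hx hy
  have ha0 : 0 ≤ ((m : ℝ) - 1) * ((m : ℝ) ^ i)⁻¹ :=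
    mul_nonneg (by linarith) (inv_pow_pos hm i).le
  have he : Real.exp (2 * logDist m x y) = Real.exp (logDist m x y) ^ 2 := by
    rw [← Real.exp_nat_mul]; norm_num
  rw [branchWeight, branchWeight, mul_div_assoc', div_le_div_iff₀ (by positivity) (by positivity),
    he, mul_assoc _ (((m : ℝ) - 1) * _), mul_left_comm, ← mul_pow]
  exact mul_le_mul_of_nonneg_left (pow_le_pow_left₀ (by linarith) h 2) ha0

end LogDist

/-! ### The cone of log-Lipschitz functions. -/

namespace LogLipschitz

variable {m : ℕ} {L L' : ℝ} {f g : ℝ → ℝ}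

lemma mono (hf : LogLipschitz m L f) (h : L ≤ L') : LogLipschitz m L' f :=
  ⟨hf.nonneg, fun x hx y hy => (hf.le x hx y hy).trans <|
    mul_le_mul_of_nonneg_right (Real.exp_le_exp.2 <|
      mul_le_mul_of_nonneg_right h (logDist_nonneg m x y)) (hf.nonneg y hy)⟩

lemma congr (hf : LogLipschitz m L f) (h : EqOn g f I) : LogLipschitz m L g :=
  ⟨fun x hx => by rw [h hx]; exact hf.nonneg x hx,
    fun x hx y hy => by rw [h hx, h hy]; exact hf.le x hx y hy⟩

lemma const_mul (hf : LogLipschitz m L f) {a : ℝ} (ha : 0 ≤ a) :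
    LogLipschitz m L fun x => a * f x :=
  ⟨fun x hx => mul_nonneg ha (hf.nonneg x hx), fun x hx y hy => by
    rw [mul_left_comm]
    exact mul_le_mul_of_nonneg_left (hf.le x hx y hy) ha⟩

lemma continuousOn (hm : 2 ≤ m) (hf : LogLipschitz m L f) : ContinuousOn f I := by
  intro x hx
  have hlog : ContinuousWithinAt (fun y => logDist m x y) I x := by
    have h1 := one_le_affine hm hx
    have : ContinuousAt (fun y : ℝ => logCoord m y) x :=
      ContinuousAt.log (by fun_prop) (by positivity)
    exact (continuousAt_const.sub this).abs.continuousWithinAt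
  have hd : Tendsto (fun y => logDist m x y) (𝓝[I] x) (𝓝 0) := by
    simpa [ContinuousWithinAt, logDist] using hlog
  have hup : Tendsto (fun y => Real.exp (L * logDist m x y) * f x) (𝓝[I] x) (𝓝 (f x)) := by
    simpa using ((hd.const_mul L).rexp).mul_const (f x)
  have hlow : Tendsto (fun y => Real.exp (-(L * logDist m x y)) * f x) (𝓝[I] x) (𝓝 (f x)) := by
    simpa using ((hd.const_mul L).neg.rexp).mul_const (f x)
  refine tendsto_of_tendsto_of_tendsto_of_le_of_le' hlow hup ?_ ?_
  · filter_upwards [self_mem_nhdsWithin] with y hy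
    rw [Real.exp_neg, inv_mul_le_iff₀ (Real.exp_pos _)]
    exact hf.le x hx y hy
  · filter_upwards [self_mem_nhdsWithin] with y hy
    rw [logDist_comm]
    exact hf.le y hy x hx

/-- A Harnack inequality: I has diameter at most log m for `logDist m`. Integrated, it compares
values of f with its mean. -/
lemma le_exp_mul (hm : 2 ≤ m) (hf : LogLipschitz m L f) (hL : 0 ≤ L) {x y : ℝ} (hx : x ∈ I)
    (hy : y ∈ I) : f x ≤ Real.exp (L * Real.log m) * f y :=
  (hf.le x hx y hy).trans <| mul_le_mul_of_nonneg_right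
    (Real.exp_le_exp.2 <| mul_le_mul_of_nonneg_left (logDist_le hm hx hy) hL) (hf.nonneg y hy)

lemma integral_le (hm : 2 ≤ m) (hf : LogLipschitz m L f) (hL : 0 ≤ L) {y : ℝ} (hy : y ∈ I) :
    ∫ x in I, f x ≤ Real.exp (L * Real.log m) * f y := by
  have := setIntegral_mono_on (μ := volume) (hf.continuousOn hm).integrableOn_Icc
    (integrableOn_const (by simp))
    measurableSet_Icc (fun x hx => hf.le_exp_mul hm hL hx hy)
  simpa using this

lemma le_integral (hm : 2 ≤ m) (hf : LogLipschitz m L f) (hL : 0 ≤ L) {y : ℝ} (hy : y ∈ I) :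
    f y ≤ Real.exp (L * Real.log m) * ∫ x in I, f x := by
  have := setIntegral_mono_on (μ := volume) (integrableOn_const (by simp))
    ((hf.continuousOn hm).integrableOn_Icc.const_mul
    (Real.exp (L * Real.log m))) measurableSet_Icc (fun x hx => hf.le_exp_mul hm hL hy hx)
  rw [integral_const_mul] at this
  simpa using this

lemma integral_nonneg (hf : LogLipschitz m L f) : 0 ≤ ∫ x in I, f x :=
  setIntegral_nonneg measurableSet_Icc hf.nonneg

/-- Termwise: the exponent of f shrinks by the contraction factor, and the weight adds 2. -/
lemma transfer (hm : 2 ≤ m) (hf : LogLipschitz m L f) (hL : 0 ≤ L) :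
    LogLipschitz m (((m : ℝ) - 1) / m * L + 2) (transfer m f) := by
  obtain ⟨B, hB⟩ := isCompact_Icc.exists_bound_of_continuousOn (hf.continuousOn hm)
  refine ⟨fun x hx => tsum_nonneg fun i =>
    mul_nonneg (branchWeight_nonneg hm i x) (hf.nonneg _ (invBranch_mem hm i hx)),
    fun x hx y hy => ?_⟩
  rw [GaussKuzmin.transfer, GaussKuzmin.transfer, ← tsum_mul_left]
  refine (summable_transfer hm hB hx).tsum_le_tsum (fun i => ?_)
    ((summable_transfer hm hB hy).mul_left _)
  have h1 := branchWeight_le_exp_logDist hm i hx hy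
  have h2 : f (invBranch m i x) ≤
      Real.exp (((m : ℝ) - 1) / m * L * logDist m x y) * f (invBranch m i y) := by
    refine (hf.le _ (invBranch_mem hm i hx) _ (invBranch_mem hm i hy)).trans
      (mul_le_mul_of_nonneg_right (Real.exp_le_exp.2 ?_) (hf.nonneg _ (invBranch_mem hm i hy)))
    have := mul_le_mul_of_nonneg_left (logDist_invBranch_le hm i hx hy) hL
    linarith
  refine (mul_le_mul h1 h2 (hf.nonneg _ (invBranch_mem hm i hx))
    (mul_nonneg (Real.exp_pos _).le (branchWeight_nonneg hm i y))).trans_eq ?_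
  rw [add_mul, Real.exp_add]
  ring

/-- Subtracting a small function of the cone `LogLipschitz m K` costs little regularity. -/
lemma sub (hm : 2 ≤ m) {K : ℝ} {ρ : ℝ → ℝ} (hg : LogLipschitz m L' g) (hρ : LogLipschitz m K ρ)
    (hL' : 0 ≤ L') (hL : L' ≤ L) (hLpos : 0 < L) (hK : 0 ≤ K)
    (h : ∀ y ∈ I, (L + K) * Real.exp (L * Real.log m) * ρ y ≤ (L - L') * g y) :
    LogLipschitz m L fun x => g x - ρ x := by
  have hm2 := two_le_cast hm
  have hlog : 0 ≤ Real.log m := Real.log_nonneg (by linarith)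
  refine ⟨fun y hy => ?_, fun x hx y hy => ?_⟩
  · have h1 : 1 ≤ Real.exp (L * Real.log m) := Real.one_le_exp (by positivity)
    have h2 : (L + K) * ρ y ≤ (L + K) * Real.exp (L * Real.log m) * ρ y :=
      mul_le_mul_of_nonneg_right (le_mul_of_one_le_right (by positivity) h1) (hρ.nonneg y hy)
    have h3 : (L - L') * g y ≤ (L + K) * g y :=
      mul_le_mul_of_nonneg_right (by linarith) (hg.nonneg y hy)
    exact sub_nonneg.2 (le_of_mul_le_mul_left (h2.trans ((h y hy).trans h3)) (by positivity))
  · set d := logDist m x y with hd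
    have hd0 : 0 ≤ d := logDist_nonneg m x y
    -- With `h1` and `h2`, it suffices that (exp(L d) - exp(-K d)) ρ y ≤ (exp(L d) - exp(L' d)) g y.
    -- Both exponential differences are compared with linear functions of d, which reduces this to
    -- `h`.
    have h1 := hg.le x hx y hy
    have h2 : Real.exp (-(K * d)) * ρ y ≤ ρ x := by
      rw [Real.exp_neg, inv_mul_le_iff₀ (Real.exp_pos _), hd, logDist_comm]
      exact hρ.le y hy x hx
    have h3 : (L - L') * d ≤ Real.exp (L * d) - Real.exp (L' * d) := by
      have e1 : Real.exp (L * d) = Real.exp (L' * d) * Real.exp ((L - L') * d) := by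
        rw [← Real.exp_add]; ring_nf
      have e2 := Real.add_one_le_exp ((L - L') * d)
      have e3 : 1 ≤ Real.exp (L' * d) := Real.one_le_exp (by positivity)
      have e4 : 0 ≤ (L - L') * d := mul_nonneg (by linarith) hd0
      rw [e1]
      nlinarith
    have h4 : Real.exp (L * d) - Real.exp (-(K * d)) ≤
        (L + K) * Real.exp (L * Real.log m) * d := by
      have e1 : Real.exp (-(K * d)) = Real.exp (L * d) * Real.exp (-((L + K) * d)) := by
        rw [← Real.exp_add]; ring_nf
      have e2 := Real.add_one_le_exp (-((L + K) * d))
      have e3 : Real.exp (L * d) ≤ Real.exp (L * Real.log m) :=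
        Real.exp_le_exp.2 (mul_le_mul_of_nonneg_left (logDist_le hm hx hy) hLpos.le)
      have e4 : 0 ≤ (L + K) * d := by positivity
      have e5 := Real.exp_pos (L * d)
      rw [e1]
      nlinarith
    have h5 := mul_le_mul_of_nonneg_right h3 (hg.nonneg y hy)
    have h6 := mul_le_mul_of_nonneg_right h4 (hρ.nonneg y hy)
    have h7 := mul_le_mul_of_nonneg_right (h y hy) hd0
    nlinarith

end LogLipschitz

/-! ### The invariant density. -/

/-- The distribution function of the invariant probability measure of `T m`. -/
def gaussCDF (m : ℕ) (x : ℝ) : ℝ :=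
  c m / ((m : ℝ) - 1) ^ 2 * Real.log ((m : ℝ) * (((m : ℝ) - 1) * x + 1) / (((m : ℝ) - 1) * x + m))

section GaussDensity

variable {m : ℕ}

lemma log_normalization_pos (hm : 2 ≤ m) : 0 < Real.log ((m : ℝ) ^ 2 / (2 * (m : ℝ) - 1)) := by
  have h2 := two_le_cast hm
  refine Real.log_pos ((one_lt_div (by linarith)).2 ?_)
  nlinarith

lemma c_pos (hm : 2 ≤ m) : 0 < c m := by
  have h2 := two_le_cast hm
  have : 0 < (m : ℝ) - 1 := by linarith
  exact div_pos (by positivity) (log_normalization_pos hm)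

lemma gaussDensity_nonneg (hm : 2 ≤ m) {x : ℝ} (hx : x ∈ I) : 0 ≤ gaussDensity m x := by
  have h1 := one_le_affine hm hx
  exact div_nonneg (c_pos hm).le (mul_nonneg (by linarith) (by linarith [two_le_cast hm]))

lemma logLipschitz_gaussDensity (hm : 2 ≤ m) : LogLipschitz m 2 (gaussDensity m) := by
  refine ⟨fun x hx => gaussDensity_nonneg hm hx, fun x hx y hy => ?_⟩
  have h2 := two_le_cast hm
  have h1 := one_le_affine hm hx
  have h1' := one_le_affine hm hy
  have h := affine_le_exp_logDist hm hx hy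
  set E := Real.exp (logDist m x y) with hE
  have he1 : 1 ≤ E := Real.one_le_exp (logDist_nonneg m x y)
  have he : Real.exp (2 * logDist m x y) = E * E := by
    rw [hE, ← Real.exp_add]; ring_nf
  have h3 : ((m : ℝ) - 1) * y + m ≤ E * (((m : ℝ) - 1) * x + m) := by nlinarith
  have h4 : ((m : ℝ) - 1) * y + 1 ≤ E * (((m : ℝ) - 1) * x + 1) := by linarith
  have h5 := mul_le_mul h4 h3 (by linarith) (by nlinarith)
  have hc := c_pos hm
  have p1 : 0 < ((m : ℝ) - 1) * x + 1 := by linarith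
  have p2 : 0 < ((m : ℝ) - 1) * x + m := by linarith
  have p3 : 0 < ((m : ℝ) - 1) * y + 1 := by linarith
  have p4 : 0 < ((m : ℝ) - 1) * y + m := by linarith
  rw [gaussDensity, gaussDensity, he, mul_div_assoc', div_le_div_iff₀ (by positivity)
    (by positivity)]
  nlinarith

/-- By partial fractions the i-th term is G (i + 1) - G i, so the sum is lim G - G 0. -/
lemma transfer_gaussDensity (hm : 2 ≤ m) :
    EqOn (transfer m (gaussDensity m)) (gaussDensity m) I := by
  intro x hx
  have h2 := two_le_cast hm
  have h1 := one_le_affine hm hx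
  have hN : 0 < (m : ℝ) - 1 := by linarith
  set s : ℝ := 1 + ((m : ℝ) - 1) * x with hs
  set F : ℕ → ℝ := fun i => c m / ((m : ℝ) - 1) * (((m : ℝ) - 1) * (((m : ℝ) ^ i)⁻¹ / m) + s)⁻¹
    with hF
  set G : ℕ → ℝ := fun i => c m / ((m : ℝ) - 1) * (((m : ℝ) - 1) * ((m : ℝ) ^ i)⁻¹ + s)⁻¹ with hG
  have hFG : ∀ i, F i = G (i + 1) := by
    intro i
    simp only [hF, hG, pow_succ, mul_inv, div_eq_mul_inv]
  have hterm : ∀ i, branchWeight m i x * gaussDensity m (invBranch m i x) = G (i + 1) - G i := by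
    intro i
    have hp := inv_pow_pos hm i
    rw [← hFG]
    simp only [branchWeight, gaussDensity, invBranch, ← hs, hF, hG]
    generalize ((m : ℝ) ^ i)⁻¹ = b at hp
    have p1 : 0 < ((m : ℝ) - 1) * b + s := by positivity
    have p2 : 0 < ((m : ℝ) - 1) * b + s * m := by positivity
    field_simp
    ring
  have hlim : Tendsto G atTop (𝓝 (c m / ((m : ℝ) - 1) * (((m : ℝ) - 1) * 0 + s)⁻¹)) := by
    have h0 := (summable_inv_pow hm).tendsto_atTop_zero
    exact (((h0.const_mul _).add_const s).inv₀ (by rw [mul_zero, zero_add]; positivity)).const_mul _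
  have hsum : HasSum (fun i => branchWeight m i x * gaussDensity m (invBranch m i x))
      (c m / ((m : ℝ) - 1) * (((m : ℝ) - 1) * 0 + s)⁻¹ - G 0) := by
    rw [hasSum_iff_tendsto_nat_of_nonneg fun i =>
      mul_nonneg (branchWeight_nonneg hm i x) (gaussDensity_nonneg hm (invBranch_mem hm i hx))]
    simp_rw [hterm, Finset.sum_range_sub]
    exact hlim.sub_const _
  rw [transfer, hsum.tsum_eq, gaussDensity]
  have e1 : ((m : ℝ) - 1) * x + 1 = s := by rw [hs]; ring
  have e2 : ((m : ℝ) - 1) * x + m = s + (m - 1) := by rw [hs]; ring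
  rw [e1, e2]
  simp only [hG, pow_zero, inv_one, mul_one, mul_zero, zero_add]
  have p3 : 0 < (m : ℝ) - 1 + s := by positivity
  have p4 : 0 < s + ((m : ℝ) - 1) := by positivity
  field_simp
  ring

lemma setIntegral_gaussDensity (hm : 2 ≤ m) {x : ℝ} (hx : x ∈ I) :
    ∫ y in I ∩ Iio x, gaussDensity m y = gaussCDF m x := by
  have h2 := two_le_cast hm
  have hN : 0 < (m : ℝ) - 1 := by linarith
  have hset : I ∩ Iio x = Ico 0 x := by
    ext y
    simp only [mem_inter_iff, mem_Icc, mem_Iio, mem_Ico]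
    exact ⟨fun h => ⟨h.1.1, h.2⟩, fun h => ⟨⟨h.1, h.2.le.trans hx.2⟩, h.2⟩⟩
  have hder : ∀ y ∈ uIcc 0 x, HasDerivAt (gaussCDF m) (gaussDensity m y) y := by
    intro y hy
    rw [uIcc_of_le hx.1] at hy
    have hyI : y ∈ I := ⟨hy.1, hy.2.trans hx.2⟩
    have h1 := one_le_affine hm hyI
    have p1 : 0 < ((m : ℝ) - 1) * y + 1 := by linarith
    have p2 : 0 < ((m : ℝ) - 1) * y + m := by linarith
    have d0 : HasDerivAt (fun y : ℝ => ((m : ℝ) - 1) * y) ((m : ℝ) - 1) y := by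
      simpa using (hasDerivAt_id y).const_mul ((m : ℝ) - 1)
    have d := ((((d0.add_const 1).const_mul (m : ℝ)).fun_div (d0.add_const (m : ℝ)) p2.ne').log
      (by positivity)).const_mul (c m / ((m : ℝ) - 1) ^ 2)
    refine d.congr_deriv ?_
    rw [gaussDensity]
    field_simp
    ring
  have hcont : ContinuousOn (gaussDensity m) (uIcc 0 x) := by
    rw [uIcc_of_le hx.1]
    exact ((logLipschitz_gaussDensity hm).continuousOn hm).mono (Icc_subset_Icc_right hx.2)
  rw [hset, setIntegral_congr_set Ico_ae_eq_Ioc, ← intervalIntegral.integral_of_le hx.1,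
    intervalIntegral.integral_eq_sub_of_hasDerivAt hder hcont.intervalIntegrable]
  have : gaussCDF m 0 = 0 := by
    simp [gaussCDF, div_self (show (m : ℝ) ≠ 0 by positivity)]
  rw [this, sub_zero]

lemma gaussCDF_nonneg (hm : 2 ≤ m) {x : ℝ} (hx : x ∈ I) : 0 ≤ gaussCDF m x := by
  rw [← setIntegral_gaussDensity hm hx]
  exact setIntegral_nonneg (measurableSet_Icc.inter measurableSet_Iio)
    fun y hy => gaussDensity_nonneg hm hy.1

lemma gaussCDF_one (hm : 2 ≤ m) : gaussCDF m 1 = 1 := by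
  have h2 := two_le_cast hm
  have hN : (m : ℝ) - 1 ≠ 0 := by linarith
  have hl := (log_normalization_pos hm).ne'
  have e : (m : ℝ) * (((m : ℝ) - 1) * 1 + 1) / (((m : ℝ) - 1) * 1 + m)
      = (m : ℝ) ^ 2 / (2 * (m : ℝ) - 1) := by ring_nf
  rw [gaussCDF, e, c, div_right_comm, div_self (pow_ne_zero 2 hN), one_div, inv_mul_cancel₀ hl]

lemma integral_gaussDensity (hm : 2 ≤ m) : ∫ y in I, gaussDensity m y = 1 := by
  rw [← gaussCDF_one hm, ← setIntegral_gaussDensity hm (right_mem_Icc.2 zero_le_one)]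
  have : (I ∩ Iio 1 : Set ℝ) = Ico 0 1 := by
    ext y
    simp only [mem_inter_iff, mem_Icc, mem_Iio, mem_Ico]
    exact ⟨fun h => ⟨h.1.1, h.2⟩, fun h => ⟨⟨h.1, h.2.le⟩, h.2⟩⟩
  rw [this]
  exact setIntegral_congr_set Ico_ae_eq_Icc.symm

end GaussDensity

/-! ### Exponential convergence to the invariant density. -/

section Convergence

variable {m : ℕ}

lemma integral_transfer (hm : 2 ≤ m) {f : ℝ → ℝ} (hf : ContinuousOn f I) :
    ∫ x in I, transfer m f x = ∫ x in I, f x := by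
  simpa using (setIntegral_preimage_T hm hf MeasurableSet.univ).symm

/-- The exponent 2m is fixed by L ↦ (m-1)/m * L + 2; doubling it leaves the slack 2 spent in
`LogLipschitz.transfer_sub`. -/
lemma LogLipschitz.transfer_self (hm : 2 ≤ m) {f : ℝ → ℝ} (hf : LogLipschitz m (4 * m) f) :
    LogLipschitz m (4 * m - 2) (GaussKuzmin.transfer m f) := by
  have h2 := two_le_cast hm
  have h := hf.transfer hm (by positivity)
  have e : ((m : ℝ) - 1) / m * (4 * m) + 2 = 4 * m - 2 := by
    field_simp
    ring
  rwa [e] at h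

lemma LogLipschitz.iterate_transfer (hm : 2 ≤ m) {f : ℝ → ℝ} (hf : LogLipschitz m (4 * m) f)
    (n : ℕ) : LogLipschitz m (4 * m) ((GaussKuzmin.transfer m)^[n] f) := by
  induction n with
  | zero => exact hf
  | succ n ih =>
    rw [Function.iterate_succ_apply']
    exact (ih.transfer_self hm).mono (by linarith)

/-- The proportion of mass that merges with the invariant density at each step. -/
def mergeRate (m : ℕ) : ℝ := 1 / (2 * m + 1) * Real.exp (-((8 * m + 2) * Real.log m))

lemma mergeRate_pos (m : ℕ) : 0 < mergeRate m := by
  unfold mergeRate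
  positivity

lemma mergeRate_lt_one (hm : 2 ≤ m) : mergeRate m < 1 := by
  have h2 := two_le_cast hm
  have h1 : Real.exp (-((8 * m + 2) * Real.log m)) ≤ 1 := by
    rw [Real.exp_le_one_iff, neg_nonpos]
    exact mul_nonneg (by positivity) (Real.log_nonneg (by linarith))
  have h3 : 1 / (2 * (m : ℝ) + 1) < 1 := by
    rw [div_lt_one (by positivity)]
    linarith
  exact (mul_le_of_le_one_right (by positivity) h1).trans_lt h3

/-- `LogLipschitz.sub` applies with K = 2 and slack 2. By Harnack, ρ is at most exp(2 log m) and P f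
at least exp(-4m log m) ∫ f; `mergeRate` is the value for which these bounds just suffice. -/
lemma LogLipschitz.transfer_sub (hm : 2 ≤ m) {f : ℝ → ℝ} (hf : LogLipschitz m (4 * m) f) :
    LogLipschitz m (4 * m) fun x =>
      GaussKuzmin.transfer m f x - mergeRate m * (∫ x in I, f x) * gaussDensity m x := by
  have h2 := two_le_cast hm
  have hρ := logLipschitz_gaussDensity hm
  have hPf := hf.transfer_self hm
  have hint := hf.integral_nonneg
  refine hPf.sub hm (hρ.const_mul (mul_nonneg (mergeRate_pos m).le hint))
    (by linarith) (by linarith) (by positivity) (by norm_num) fun y hy => ?_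
  have h3 := hρ.le_integral hm (by norm_num) hy
  rw [integral_gaussDensity hm, mul_one] at h3
  have h4 := (hPf.mono (show (4 * m - 2 : ℝ) ≤ 4 * m by linarith)).integral_le hm
    (by positivity) hy
  rw [integral_transfer hm (hf.continuousOn hm)] at h4
  set ℓ := Real.log m
  set J := ∫ x in I, f x
  have e : Real.exp (-((8 * m + 2) * ℓ))
      = (Real.exp (4 * m * ℓ) * Real.exp (4 * m * ℓ) * Real.exp (2 * ℓ))⁻¹ := by
    rw [← Real.exp_add, ← Real.exp_add, ← Real.exp_neg]
    ring_nf
  calc (4 * m + 2 : ℝ) * Real.exp (4 * m * ℓ) * (mergeRate m * J * gaussDensity m y)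
      ≤ (4 * m + 2 : ℝ) * Real.exp (4 * m * ℓ) * (mergeRate m * J * Real.exp (2 * ℓ)) := by
        have := mergeRate_pos m
        gcongr
    _ = 2 * (J / Real.exp (4 * m * ℓ)) := by
        rw [mergeRate, e]
        have := Real.exp_pos (4 * m * ℓ)
        have := Real.exp_pos (2 * ℓ)
        field_simp
        ring
    _ ≤ (4 * m - (4 * m - 2) : ℝ) * GaussKuzmin.transfer m f y := by
        have : J / Real.exp (4 * m * ℓ) ≤ GaussKuzmin.transfer m f y := by
          rwa [div_le_iff₀' (Real.exp_pos _)]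
        linarith

lemma exists_iterate_transfer_eq (hm : 2 ≤ m) {f : ℝ → ℝ} (hf : LogLipschitz m (4 * m) f) (n : ℕ) :
    ∃ g, LogLipschitz m (4 * m) g ∧ ∫ x in I, g x = ∫ x in I, f x ∧
      EqOn ((transfer m)^[n] f) (fun x => (1 - (1 - mergeRate m) ^ n) * (∫ x in I, f x) *
        gaussDensity m x + (1 - mergeRate m) ^ n * g x) I := by
  have hρ := (logLipschitz_gaussDensity hm).continuousOn hm
  have hq : 0 < 1 - mergeRate m := sub_pos.2 (mergeRate_lt_one hm)
  induction n with
  | zero => exact ⟨f, hf, rfl, fun x _ => by simp⟩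
  | succ n ih =>
    obtain ⟨g, hg, hgint, heq⟩ := ih
    set J := ∫ x in I, f x
    refine ⟨fun x => (1 - mergeRate m)⁻¹ * (transfer m g x - mergeRate m * (∫ x in I, g x) *
      gaussDensity m x), (hg.transfer_sub hm).const_mul (inv_nonneg.2 hq.le), ?_, fun x hx => ?_⟩
    · rw [integral_const_mul, integral_sub ((hg.transfer_self hm).continuousOn hm).integrableOn_Icc
        (hρ.integrableOn_Icc.const_mul _), integral_const_mul, integral_gaussDensity hm,
        integral_transfer hm (hg.continuousOn hm), hgint]
      field_simp
    · rw [Function.iterate_succ_apply', transfer_congr hm heq hx,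
        transfer_add_smul hm hρ (hg.continuousOn hm) _ _ hx, transfer_gaussDensity hm hx, hgint]
      field_simp
      ring

/-- The constant in the exponential convergence to the invariant density. -/
def convConst (m : ℕ) : ℝ := Real.exp (4 * m * Real.log m) * Real.exp (2 * Real.log m)

lemma convConst_pos (m : ℕ) : 0 < convConst m := by
  unfold convConst
  positivity

lemma one_le_convConst (hm : 2 ≤ m) : 1 ≤ convConst m := by
  have h2 := two_le_cast hm
  have hl : 0 ≤ Real.log m := Real.log_nonneg (by linarith)
  exact one_le_mul_of_one_le_of_one_le (Real.one_le_exp (by positivity))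
    (Real.one_le_exp (by positivity))

/-- With J = ∫ f, both the remainder g and J ρ lie between 0 and `convConst m` * J * ρ; this
constant is the product of the Harnack constants of g and ρ. -/
lemma abs_iterate_transfer_sub_le (hm : 2 ≤ m) {f : ℝ → ℝ} (hf : LogLipschitz m (4 * m) f) (n : ℕ)
    {x : ℝ} (hx : x ∈ I) :
    |(transfer m)^[n] f x - (∫ x in I, f x) * gaussDensity m x| ≤
      convConst m * (∫ x in I, f x) * (1 - mergeRate m) ^ n * gaussDensity m x := by
  obtain ⟨g, hg, hgint, heq⟩ := exists_iterate_transfer_eq hm hf n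
  have hq : 0 < 1 - mergeRate m := sub_pos.2 (mergeRate_lt_one hm)
  have hρ := logLipschitz_gaussDensity hm
  have h1 := hg.le_integral hm (by positivity) hx
  have h2 := hρ.integral_le hm (by norm_num) hx
  rw [integral_gaussDensity hm] at h2
  rw [hgint] at h1
  have hJ := hf.integral_nonneg
  set J := ∫ x in I, f x
  have h3 : g x ≤ convConst m * J * gaussDensity m x := by
    refine h1.trans ?_
    have := mul_le_mul_of_nonneg_left h2 (mul_nonneg (Real.exp_pos (4 * m * Real.log m)).le hJ)
    rw [convConst]
    linarith
  have h4 : J * gaussDensity m x ≤ convConst m * J * gaussDensity m x := by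
    rw [mul_assoc]
    exact le_mul_of_one_le_left (mul_nonneg hJ (gaussDensity_nonneg hm hx)) (one_le_convConst hm)
  have h5 : |g x - J * gaussDensity m x| ≤ convConst m * J * gaussDensity m x :=
    abs_sub_le_of_nonneg_of_le (hg.nonneg x hx) h3
      (mul_nonneg hJ (gaussDensity_nonneg hm hx)) h4
  have e : (transfer m)^[n] f x - J * gaussDensity m x
      = (1 - mergeRate m) ^ n * (g x - J * gaussDensity m x) := by
    rw [heq hx]
    ring
  rw [e, abs_mul, abs_of_pos (pow_pos hq n)]
  refine (mul_le_mul_of_nonneg_left h5 (pow_pos hq n).le).trans_eq ?_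
  ring

lemma setIntegral_preimage_iterate_T (hm : 2 ≤ m) {A : Set ℝ} (hA : MeasurableSet A) (n : ℕ) :
    ∀ {f : ℝ → ℝ}, LogLipschitz m (4 * m) f →
      ∫ x in I ∩ (T m)^[n] ⁻¹' A, f x = ∫ x in I ∩ A, (transfer m)^[n] f x := by
  induction n with
  | zero => intro f _; rfl
  | succ n ih =>
    intro f hf
    rw [Function.iterate_succ, preimage_comp, setIntegral_preimage_T hm (hf.continuousOn hm)
      (((measurable_T m).iterate n) hA), ih ((hf.transfer_self hm).mono (by linarith))]
    rfl

lemma abs_setIntegral_iterate_sub_le_of_logLipschitz (hm : 2 ≤ m) {f : ℝ → ℝ}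
    (hf : LogLipschitz m (4 * m) f) (n : ℕ) {x : ℝ} (hx : x ∈ I) :
    |(∫ y in I ∩ (T m)^[n] ⁻¹' Iio x, f y) - (∫ y in I, f y) * gaussCDF m x| ≤
      convConst m * (∫ y in I, f y) * (1 - mergeRate m) ^ n * gaussCDF m x := by
  have hρ := ((logLipschitz_gaussDensity hm).continuousOn hm).integrableOn_Icc (μ := volume)
    |>.mono_set (inter_subset_left (t := Iio x))
  have hPf := ((hf.iterate_transfer hm n).continuousOn hm).integrableOn_Icc (μ := volume)
    |>.mono_set (inter_subset_left (t := Iio x))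
  rw [setIntegral_preimage_iterate_T hm measurableSet_Iio n hf, ← setIntegral_gaussDensity hm hx,
    ← integral_const_mul, ← integral_const_mul, ← integral_sub hPf (hρ.const_mul _)]
  exact norm_integral_le_of_norm_le (f := fun y => (transfer m)^[n] f y -
    (∫ x in I, f x) * gaussDensity m y) (hρ.const_mul _) <|
    ae_restrict_of_forall_mem (measurableSet_Icc.inter measurableSet_Iio) fun y hy =>
      abs_iterate_transfer_sub_le hm hf n hy.1

lemma logLipschitz_const {a : ℝ} (ha : 0 ≤ a) : LogLipschitz m (4 * m) fun _ => a :=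
  ⟨fun _ _ => ha, fun x _ y _ => le_mul_of_one_le_left ha
    (Real.one_le_exp (mul_nonneg (by positivity) (logDist_nonneg m x y)))⟩

/-- The constant makes the function at least K m, so an increment of at most K m d is at most d
times its value, and 1 + d ≤ exp(4 m d). -/
lemma logLipschitz_add_const (hm : 2 ≤ m) {f : ℝ → ℝ} {K : ℝ≥0} (hf : LipschitzOnWith K f I)
    {B : ℝ} (hB : ∀ x ∈ I, |f x| ≤ B) : LogLipschitz m (4 * m) fun x => f x + (K * m + B) := by
  have h2 := two_le_cast hm
  refine ⟨fun x hx => ?_, fun x hx y hy => ?_⟩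
  · have := (abs_le.1 (hB x hx)).1
    have : 0 ≤ (K : ℝ) * m := by positivity
    linarith
  · have h1 : f x - f y ≤ K * m * logDist m x y := by
      refine (le_abs_self _).trans ((hf.dist_le_mul x hx y hy).trans ?_)
      rw [mul_assoc]
      exact mul_le_mul_of_nonneg_left (abs_sub_le_logDist hm hx hy) K.2
    have hd := logDist_nonneg m x y
    have h3 : 1 + logDist m x y ≤ Real.exp (4 * m * logDist m x y) := by
      have := Real.add_one_le_exp (4 * m * logDist m x y)
      nlinarith
    have h4 := (abs_le.1 (hB y hy)).1
    have h5 : 0 ≤ (K : ℝ) * m := by positivity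
    have h6 := mul_le_mul_of_nonneg_right h3 (show 0 ≤ f y + (K * m + B) by linarith)
    refine le_trans ?_ h6
    nlinarith

/-- Exponential decay of correlations of `T m` for Lipschitz densities. -/
theorem exists_abs_setIntegral_iterate_sub_le (hm : 2 ≤ m) {f : ℝ → ℝ} {K : ℝ≥0}
    (hf : LipschitzOnWith K f I) : ∃ k : ℝ, 0 < k ∧ ∀ n : ℕ, ∀ x ∈ I,
      |(∫ y in I ∩ (T m)^[n] ⁻¹' Iio x, f y) - (∫ y in I, f y) * gaussCDF m x| ≤
        k * (1 - mergeRate m) ^ n * gaussCDF m x := by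
  obtain ⟨B, hB⟩ := isCompact_Icc.exists_bound_of_continuousOn hf.continuousOn
  have hB0 : 0 ≤ B := (norm_nonneg _).trans (hB 0 (left_mem_Icc.2 zero_le_one))
  set M : ℝ := K * m + B with hM
  have hM0 : 0 ≤ M := by positivity
  have hg := logLipschitz_add_const hm hf hB
  have hfi : IntegrableOn f I := hf.continuousOn.integrableOn_Icc
  have hMi : IntegrableOn (fun _ => M) I := integrableOn_const (μ := volume) (by simp)
  have hM1 : ∫ _ in I, M = M := by simp
  have hC := convConst_pos m
  have hgint := hg.integral_nonneg
  -- f = (f + M) - M adds the errors of two cone functions; the final 1 only ensures positivity.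
  refine ⟨convConst m * ((∫ y in I, (f y + M)) + M) + 1, by positivity, fun n x hx => ?_⟩
  have h1 := abs_setIntegral_iterate_sub_le_of_logLipschitz hm hg n hx
  have h2 := abs_setIntegral_iterate_sub_le_of_logLipschitz hm (logLipschitz_const hM0) n hx
  rw [hM1] at h2
  have hq : 0 < 1 - mergeRate m := sub_pos.2 (mergeRate_lt_one hm)
  have e1 : ∫ y in I ∩ (T m)^[n] ⁻¹' Iio x, (f y + M) =
      (∫ y in I ∩ (T m)^[n] ⁻¹' Iio x, f y) + ∫ _ in I ∩ (T m)^[n] ⁻¹' Iio x, M :=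
    integral_add (hfi.mono_set inter_subset_left) (hMi.mono_set inter_subset_left)
  have e2 : ∫ y in I, (f y + M) = (∫ y in I, f y) + M := by
    rw [integral_add hfi hMi, hM1]
  have h3 : 0 ≤ (1 - mergeRate m) ^ n * gaussCDF m x :=
    mul_nonneg (pow_pos hq n).le (gaussCDF_nonneg hm hx)
  rw [← hM, e1] at h1
  rw [abs_le] at h1 h2 ⊢
  rw [e2] at h1 ⊢
  constructor <;> nlinarith [h1.1, h1.2, h2.1, h2.2]

lemma measurableSet_preimage_iterate_T (m n : ℕ) (x : ℝ) :
    MeasurableSet (I ∩ (T m)^[n] ⁻¹' Iio x) :=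
  measurableSet_Icc.inter (((measurable_T m).iterate n) measurableSet_Iio)

end Convergence

/-! ### Integrable densities, by approximation. -/

variable {m : ℕ}

lemma gaussCDF_le_one (hm : 2 ≤ m) {x : ℝ} (hx : x ∈ I) : gaussCDF m x ≤ 1 := by
  rw [← integral_gaussDensity hm, ← setIntegral_gaussDensity hm hx]
  exact setIntegral_mono_set ((logLipschitz_gaussDensity hm).continuousOn hm).integrableOn_Icc
    (ae_restrict_of_forall_mem measurableSet_Icc fun y hy => gaussDensity_nonneg hm hy)
    (ae_of_all _ fun _ h => h.1)

lemma exists_polynomial_integral_sub_le {f : ℝ → ℝ} (hf : IntegrableOn f I) {ε : ℝ} (hε : 0 < ε) :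
    ∃ p : Polynomial ℝ, ∫ x in I, |f x - p.eval x| ≤ ε := by
  obtain ⟨g, -, hg, hgc, hgi⟩ := hf.exists_hasCompactSupport_integral_sub_le (half_pos hε)
  obtain ⟨p, hp⟩ := exists_polynomial_near_of_continuousOn 0 1 g hgc.continuousOn _ (half_pos hε)
  refine ⟨p, ?_⟩
  have hpi : IntegrableOn (fun x => p.eval x) I := p.continuous.continuousOn.integrableOn_Icc
  have h1 : ∫ x in I, |g x - p.eval x| ≤ ε / 2 := by
    have := setIntegral_mono_on (μ := volume) (hgi.sub hpi).abs
      (integrableOn_const (C := ε / 2) (by simp)) measurableSet_Icc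
      fun x hx => by
        rw [Pi.sub_apply, abs_sub_comm]
        exact (hp x hx).le
    simpa using this
  have h2 : ∫ x in I, |f x - p.eval x| ≤ ∫ x in I, (‖f x - g x‖ + |g x - p.eval x|) :=
    integral_mono (hf.sub hpi).abs ((hf.sub hgi).norm.add (hgi.sub hpi).abs)
      fun x => abs_sub_le _ _ _
  have h3 := integral_add (hf.sub hgi).norm (hgi.sub hpi).abs
  simp only [Pi.sub_apply] at h3
  rw [h3] at h2
  linarith

lemma exists_lipschitzOnWith_polynomial (p : Polynomial ℝ) :
    ∃ K : ℝ≥0, LipschitzOnWith K (fun x => p.eval x) I :=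
  (show ContDiff ℝ 1 fun x => p.eval x by simpa using p.contDiff_aeval (𝕜 := ℝ) 1).contDiffOn
    |>.exists_lipschitzOnWith one_ne_zero (convex_Icc 0 1) isCompact_Icc

/-- `T m` is mixing for every integrable density. -/
theorem tendsto_setIntegral_iterate (hm : 2 ≤ m) {f : ℝ → ℝ} (hf : IntegrableOn f I) {x : ℝ}
    (hx : x ∈ I) : Tendsto (fun n : ℕ => ∫ y in I ∩ (T m)^[n] ⁻¹' Iio x, f y) atTop
      (𝓝 ((∫ y in I, f y) * gaussCDF m x)) := by
  rw [Metric.tendsto_atTop]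
  intro ε hε
  obtain ⟨p, hp⟩ := exists_polynomial_integral_sub_le hf (show 0 < ε / 3 by positivity)
  obtain ⟨K, hK⟩ := exists_lipschitzOnWith_polynomial p
  obtain ⟨k, hk, h⟩ := exists_abs_setIntegral_iterate_sub_le hm hK
  have hpi : IntegrableOn (fun x => p.eval x) I := p.continuous.continuousOn.integrableOn_Icc
  have hq : 0 < 1 - mergeRate m := sub_pos.2 (mergeRate_lt_one hm)
  have hlim : Tendsto (fun n : ℕ => k * (1 - mergeRate m) ^ n * gaussCDF m x) atTop (𝓝 0) := by
    simpa using ((tendsto_pow_atTop_nhds_zero_of_lt_one hq.le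
      (by linarith [mergeRate_pos m])).const_mul k).mul_const (gaussCDF m x)
  obtain ⟨n₀, hn₀⟩ :=
    (hlim.eventually (gt_mem_nhds (show 0 < ε / 3 by positivity))).exists_forall_of_atTop
  refine ⟨n₀, fun n hn => ?_⟩
  -- The approximation error is uniform over subsets of I, hence in n.
  have hdiff : ∀ S ⊆ I, |(∫ y in S, f y) - ∫ y in S, p.eval y| ≤ ε / 3 := by
    intro S hS
    rw [← integral_sub (hf.mono_set hS) (hpi.mono_set hS)]
    refine (abs_integral_le_integral_abs).trans (le_trans ?_ hp)
    exact setIntegral_mono_set (hf.sub hpi).abs (ae_of_all _ fun _ => abs_nonneg _)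
      (ae_of_all _ fun _ h => hS h)
  have h1 := abs_le.1 (hdiff (I ∩ (T m)^[n] ⁻¹' Iio x) inter_subset_left)
  have h3 := abs_lt.1 ((h n x hx).trans_lt (hn₀ n hn))
  have h4 : |(∫ y in I, f y) * gaussCDF m x - (∫ y in I, p.eval y) * gaussCDF m x| ≤ ε / 3 := by
    rw [← sub_mul, abs_mul, abs_of_nonneg (gaussCDF_nonneg hm hx)]
    exact (mul_le_of_le_one_right (abs_nonneg _) (gaussCDF_le_one hm hx)).trans (hdiff I Subset.rfl)
  rw [Real.dist_eq, abs_lt]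
  have h4' := abs_le.1 h4
  constructor <;> linarith [h1.1, h1.2, h4'.1, h4'.2, h3.1, h3.2]

/-- `IsDensity` does not include measurability of h, so the Radon–Nikodym derivative of μ serves as
f. -/
lemma exists_integrable_density {μ : Measure ℝ} [IsProbabilityMeasure μ] {h : ℝ → ℝ}
    (hμ : IsDensity μ h) : ∃ f : ℝ → ℝ, IntegrableOn f I ∧ ∫ x in I, f x = 1 ∧
      ∀ S ⊆ I, MeasurableSet S → μ.real S = ∫ x in S, f x := by
  have hac : μ ≪ volume.restrict I := by
    rw [hμ.2]
    exact withDensity_absolutelyContinuous _ _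
  have hset : ∀ S : Set ℝ, S ⊆ I → MeasurableSet S →
      μ.real S = ∫ x in S, (μ.rnDeriv (volume.restrict I) x).toReal := by
    intro S hS hSm
    rw [← Measure.setIntegral_toReal_rnDeriv hac S, Measure.restrict_restrict hSm,
      inter_eq_self_of_subset_left hS]
  refine ⟨fun x => (μ.rnDeriv (volume.restrict I) x).toReal,
    Measure.integrable_toReal_rnDeriv, ?_, hset⟩
  rw [← hset I Subset.rfl measurableSet_Icc]
  have : μ Iᶜ = 0 := hac (by simp)
  rw [measureReal_def, (prob_compl_eq_zero_iff measurableSet_Icc).1 this, ENNReal.toReal_one]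

lemma measureReal_eq_setIntegral_of_continuousOn {μ : Measure ℝ} {h : ℝ → ℝ}
    (hμ : IsDensity μ h) (hc : ContinuousOn h I) {S : Set ℝ} (hS : S ⊆ I) (hSm : MeasurableSet S) :
    μ.real S = ∫ x in S, h x := by
  have hnn : 0 ≤ᵐ[volume.restrict S] h := ae_mono (Measure.restrict_mono hS le_rfl) hμ.1
  rw [integral_eq_lintegral_of_nonneg_ae hnn ((hc.mono hS).aestronglyMeasurable hSm),
    measureReal_def, hμ.2, withDensity_apply _ hSm, Measure.restrict_restrict hSm,
    inter_eq_self_of_subset_left hS]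

end
end GaussKuzmin

theorem theorem5p1 (m : ℕ) (hm : 2 ≤ m) (μ : Measure ℝ) [IsProbabilityMeasure μ]
    (h : ℝ → ℝ) (hμ : GaussKuzmin.IsDensity μ h) :
    (GaussKuzmin.RiemannIntegrable h →
      ∀ x ∈ GaussKuzmin.I,
        Tendsto (fun n : ℕ => μ.real {ω ∈ GaussKuzmin.I | (GaussKuzmin.T m)^[n] ω < x}) atTop
          (𝓝 (GaussKuzmin.c m / ((m : ℝ) - 1) ^ 2 *
            Real.log ((m : ℝ) * (((m : ℝ) - 1) * x + 1) / (((m : ℝ) - 1) * x + m))))) ∧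
    ((∃ K : ℝ≥0, LipschitzOnWith K h GaussKuzmin.I) →
      ∃ q k : ℝ, 0 < q ∧ q < 1 ∧ 0 < k ∧
        ∀ x ∈ GaussKuzmin.I, ∀ n : ℕ, 1 ≤ n →
          ∃ θ : ℝ, |θ| ≤ k ∧
            μ.real {ω ∈ GaussKuzmin.I | (GaussKuzmin.T m)^[n] ω < x} =
              GaussKuzmin.c m / ((m : ℝ) - 1) ^ 2 * (1 + θ * q ^ n) *
                Real.log ((m : ℝ) * (((m : ℝ) - 1) * x + 1) / (((m : ℝ) - 1) * x + m))) := by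
  constructor
  · intro _ x hx
    obtain ⟨f, hfi, hf1, hf⟩ := GaussKuzmin.exists_integrable_density hμ
    have hlim := GaussKuzmin.tendsto_setIntegral_iterate hm hfi hx
    rw [hf1, one_mul] at hlim
    refine hlim.congr fun n => ?_
    exact (hf _ inter_subset_left (GaussKuzmin.measurableSet_preimage_iterate_T m n x)).symm
  · rintro ⟨K, hK⟩
    obtain ⟨k, hk, hbound⟩ := GaussKuzmin.exists_abs_setIntegral_iterate_sub_le hm hK
    have hq : 0 < 1 - GaussKuzmin.mergeRate m := sub_pos.2 (GaussKuzmin.mergeRate_lt_one hm)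
    have hint : ∫ y in GaussKuzmin.I, h y = 1 := by
      obtain ⟨f, -, hf1, hf⟩ := GaussKuzmin.exists_integrable_density hμ
      rw [← GaussKuzmin.measureReal_eq_setIntegral_of_continuousOn hμ hK.continuousOn Subset.rfl
        measurableSet_Icc, hf _ Subset.rfl measurableSet_Icc, hf1]
    refine ⟨1 - GaussKuzmin.mergeRate m, k, hq, by linarith [GaussKuzmin.mergeRate_pos m], hk,
      fun x hx n _ => ?_⟩
    have h1 := hbound n x hx
    rw [hint, one_mul, ← GaussKuzmin.measureReal_eq_setIntegral_of_continuousOn hμ hK.continuousOn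
      inter_subset_left (GaussKuzmin.measurableSet_preimage_iterate_T m n x)] at h1
    set G := GaussKuzmin.gaussCDF m x with hG
    set M := μ.real (GaussKuzmin.I ∩ (GaussKuzmin.T m)^[n] ⁻¹' Iio x) with hM
    have hG0 : 0 ≤ G := GaussKuzmin.gaussCDF_nonneg hm hx
    have hqn := pow_pos hq n
    -- Solving M = G (1 + θ q^n) for θ. If G = 0, division by zero makes θ = 0, and the bound `h1`
    -- forces M = 0.
    refine ⟨(M - G) / ((1 - GaussKuzmin.mergeRate m) ^ n * G), ?_, ?_⟩
    · rw [abs_div, abs_of_nonneg (mul_nonneg hqn.le hG0)]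
      exact div_le_of_le_mul₀ (mul_nonneg hqn.le hG0) hk.le (by rwa [← mul_assoc])
    · change M = _
      rw [mul_right_comm]
      change M = G * _
      rcases hG0.eq_or_lt with h0 | hpos
      · rw [← h0, mul_zero, sub_zero] at h1
        rw [← h0, zero_mul, abs_nonpos_iff.1 h1]
      · field_simp
        ring
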